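/- Let $\mathbb F_q$ be a finite field with $q$ elements, $\theta:(\mathbb F_q,+)\to\mathbb C^*$ a nontrivial linear character, $\lambda=(\lambda_1,\dots,\lambda_k)$ a composition of $n$ (zero parts allowed) and $\mathfrak s$ a row standard $\lambda$-tableau. Write $\mathrm{row}(i)$ for the row of $\mathfrak s$ containing $i$, let $d\in S_n$ be the permutation taking the initial tableau $\mathfrak t^\lambda$ (the numbers $1,\dots,n$ in order along the rows) to $\mathfrak s$, and identify $d$ with its permutation matrix, so that $(dA)_{a,b}=A_{ad,b}$. Put $$J=\{(i,j): j<i,\ \mathrm{row}(i)>\mathrm{row}(j)\},\quad L=\{(i,j): j<i,\ \mathrm{row}(i)=\mathrm{row}(j)\},\quad K=J\cup L.$$ For $S\subseteq\{(i,j):j<i\}$ let $V_S$ be the space of $n\times n$ matrices over $\mathbb F_q$ supported in $S$; for closed $S$ let $U_S=\{E+A: A\in V_S\}$, and let $U$ be the group of all lower unitriangular matrices. Let $x_{ij}(\alpha)=E+\alpha e_{ij}$, and let $\rho:U_K\to U_L$ be the projection replacing the entries in $J$ by $0$. The group $U_K$ acts on $V_J$ by $A\circ g=\rho(g^{-1})Ag$,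 the map $f(g)=\rho(g^{-1})g-E$ is a 1-cocycle $U_K\to V_J$, and $\mathbb C(V_J,+)\cong\mathbb C^{V_J}$ is a right $\mathbb CU_K$-module by $(\tau g)(v)=\tau(v\circ g^{-1}+f(g^{-1}))$; on linear characters $\chi$ of $V_J$ this is the monomial action $\chi g=\chi(f(g^{-1}))\,\chi.g$ with $(\chi.g)(v)=\chi(v\circ g^{-1})$. For $A\in V_J$ put $\chi_A(B)=\theta\big(\sum_{(i,j)\in J}A_{ij}B_{ij}\big)$ and $$e_A=q^{-|J|}\sum_{B\in V_J}\overline{\chi_A(B)}\,B\in\mathbb C(V_J,+).$$ Let $\mathfrak X^0_{\mathfrak s}=dV_J=\{du-d:u\in U_J\}$, let $e_{dA}\in\mathbb C(\mathfrak X^0_{\mathfrak s},+)$ be the image of $e_A$ under the isomorphism of group algebras extending $A\mapsto dA$, and let $U_K$ act on $\mathbb C(\mathfrak X^0_{\mathfrak s},+)$ by transport along it. Let $P_\lambda\le GL_n(q)$ be the standard (block upper triangular) parabolic subgroup, $\overline{P_\lambda}=\sum_{h\in P_\lambda}h$, and let $M_{\mathfrak s}\subseteq \mathbb CGL_n(q)$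 be the $\mathbb C$-span of all $\overline{P_\lambda}\,d\,u$, $u\in U$. In a matrix $dA$ give the $a$-th row the label $ad$, so that the entry with row label $i$ and column $j$ is $A_{ij}$; truncating means setting to $0$ all entries whose position (row label, column) is not in $J$. The rows with labels in one row of $\mathfrak s$ form a compartment; the highest (lowest) compartment belongs to the first (last) nonempty row of $\mathfrak s$. **Theorem 4.9.** The elements $e_{dA}$, $A\in V_J$, form a $\mathbb C$-basis of $\mathbb C(\mathfrak X_{\mathfrak s}^0,+)$, and the linear map $du-d\mapsto \overline{P_\lambda}\,du$ $(u\in U_J)$ is an isomorphism of right $\mathbb CU_K$-modules from $\mathbb C(\mathfrak X_{\mathfrak s}^0,+)$ onto $M_{\mathfrak s}$, where $U_K$ acts on $M_{\mathfrak s}$ by right multiplication. Let $(i,j)\in K$, $\alpha\in\mathbb F_q$, $A\in V_J$. 1. If $(i,j)\in J$, then $e_{dA}\,x_{ij}(\alpha)=\theta(A_{ij}\alpha)\,e_{dB}$, where $dB$ is obtained from $dA$ by adding $-\alpha$ times column $j$ to column $i$ and truncating. 2. If $(i,j)\in L$, then $e_{dA}\,x_{ij}(\alpha)=e_{dB}$,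 where $dB$ is obtained from $dA$ by adding $-\alpha$ times column $j$ to column $i$, adding $\alpha$ times the row labelled $i$ to the row labelled $j$, and truncating. 3. If $(i,j)\in L$ and the row of $\mathfrak s$ containing $i$ and $j$ is the highest compartment, then $e_{dA}\,x_{ij}(\alpha)=e_{dB}$, where $dB$ is obtained from $dA$ by adding $-\alpha$ times column $j$ to column $i$ and truncating (no row operation). 4. If $(i,j)\in L$ and the row of $\mathfrak s$ containing $i$ and $j$ is the lowest compartment, then $e_{dA}\,x_{ij}(\alpha)=e_{dB}$, where $dB$ is obtained from $dA$ by adding $\alpha$ times the row labelled $i$ to the row labelled $j$ and truncating (no column operation). -/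

import Mathlib

open scoped Matrix

noncomputable section

namespace SComp

/-! ### Tableaux and permutations -/

section Tableaux

variable {k : ℕ} {lam : Fin k → ℕ}

/-- Index set `{1, …, n}` (shifted to start at `0`), where `lam = (lam_1, …, lam_k)` is a
composition of `n`, that is, `n` is the sum of the (possibly zero) parts of `lam`. -/
abbrev Idx {k : ℕ} (lam : Fin k → ℕ) : Type := Fin (∑ r, lam r)

/-- A `lam`-tableau: a bijection from the nodes `(row, column)` of the Young diagram of `lam` onto
`{1, …, n}`. -/
abbrev Tableau {k : ℕ} (lam : Fin k → ℕ) : Type := ((r : Fin k) × Fin (lam r)) ≃ Idx lam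

/-- Entries increase along rows. -/
def IsRowStandard (s : Tableau lam) : Prop :=
  ∀ r : Fin k, StrictMono fun c : Fin (lam r) => s ⟨r, c⟩

/-- The initial tableau: `1, …, n` inserted in order along the rows, row by row. -/
def initial (lam : Fin k → ℕ) : Tableau lam := finSigmaFinEquiv

/-- The row of the tableau `s` containing `i`. -/
def row (s : Tableau lam) (i : Idx lam) : Fin k := (s.symm i).1

/-- The permutation `d` with `(initial lam) d = s`, permutations acting from the right on
entries. -/
def dperm (s : Tableau lam) : Equiv.Perm (Idx lam) := (initial lam).symm.trans s

theorem row_dperm (s : Tableau lam) (a : Idx lam) : row s (dperm s a) = row (initial lam) a := by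
  simp [row, dperm]

/-- The negative roots `(i, j)` with `j < i`. -/
def negRoots (lam : Fin k → ℕ) : Finset (Idx lam × Idx lam) :=
  Finset.univ.filter fun p => p.2 < p.1

/-- `J = {(i, j) : j < i, row i > row j}`. -/
def setJ (s : Tableau lam) : Finset (Idx lam × Idx lam) :=
  (negRoots lam).filter fun p => row s p.2 < row s p.1

/-- `L = {(i, j) : j < i, row i = row j}`. -/
def setL (s : Tableau lam) : Finset (Idx lam × Idx lam) :=
  (negRoots lam).filter fun p => row s p.1 = row s p.2

/-- `K = {(i, j) : j < i, row i ≥ row j}`. -/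
def setK (s : Tableau lam) : Finset (Idx lam × Idx lam) :=
  (negRoots lam).filter fun p => row s p.2 ≤ row s p.1

theorem mem_negRoots {i j : Idx lam} : (i, j) ∈ negRoots lam ↔ j < i := by simp [negRoots]

theorem mem_setJ {s : Tableau lam} {i j : Idx lam} :
    (i, j) ∈ setJ s ↔ j < i ∧ row s j < row s i := by simp [setJ, negRoots]

theorem mem_setL {s : Tableau lam} {i j : Idx lam} :
    (i, j) ∈ setL s ↔ j < i ∧ row s i = row s j := by simp [setL, negRoots]

theorem mem_setK {s : Tableau lam} {i j : Idx lam} :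
    (i, j) ∈ setK s ↔ j < i ∧ row s j ≤ row s i := by simp [setK, negRoots]

theorem setJ_subset_setK (s : Tableau lam) : setJ s ⊆ setK s := by
  rintro ⟨i, j⟩ h
  rw [mem_setJ] at h
  exact mem_setK.2 ⟨h.1, h.2.le⟩

theorem setL_subset_setK (s : Tableau lam) : setL s ⊆ setK s := by
  rintro ⟨i, j⟩ h
  rw [mem_setL] at h
  exact mem_setK.2 ⟨h.1, h.2.ge⟩

/-- A set of roots is closed if `(i, j)` and `(j, l)` in it imply `(i, l)` in it (for sets of
negative roots `(i, l)` is automatically a root). -/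
def ClosedRoots {m : ℕ} (S : Finset (Fin m × Fin m)) : Prop :=
  ∀ i j l, (i, j) ∈ S → (j, l) ∈ S → (i, l) ∈ S

theorem closed_negRoots (lam : Fin k → ℕ) : ClosedRoots (negRoots lam) := by
  intro i j l h1 h2
  rw [mem_negRoots] at *
  exact h2.trans h1

theorem closed_setK (s : Tableau lam) : ClosedRoots (setK s) := by
  intro i j l h1 h2
  rw [mem_setK] at *
  exact ⟨h2.1.trans h1.1, h2.2.trans h1.2⟩

end Tableaux

/-! ### Pattern spaces and pattern subgroups -/

section Pattern

variable (F : Type*) [Field F] {m : ℕ}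

/-- `V_S`: the space of matrices supported in `S`. -/
def suppSpace (S : Finset (Fin m × Fin m)) : Submodule F (Matrix (Fin m) (Fin m) F) where
  carrier := {A | ∀ i j, (i, j) ∉ S → A i j = 0}
  add_mem' := by
    intro A B hA hB i j h
    simp [hA i j h, hB i j h]
  zero_mem' := by
    intro i j _
    rfl
  smul_mem' := by
    intro c A hA i j h
    simp [hA i j h]

variable {F}

/-- `π_S`: set all entries outside `S` to zero. -/
def proj (S : Finset (Fin m × Fin m)) (A : Matrix (Fin m) (Fin m) F) :
    Matrix (Fin m) (Fin m) F :=
  Matrix.of fun i j => if (i, j) ∈ S then A i j else 0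

theorem proj_mem (S : Finset (Fin m × Fin m)) (A : Matrix (Fin m) (Fin m) F) :
    proj S A ∈ suppSpace F S := by
  intro i j h
  simp [proj, h]

theorem mul_mem_suppSpace {S : Finset (Fin m × Fin m)} (hS : ClosedRoots S)
    {A B : Matrix (Fin m) (Fin m) F} (hA : A ∈ suppSpace F S) (hB : B ∈ suppSpace F S) :
    A * B ∈ suppSpace F S := by
  intro i j h
  rw [Matrix.mul_apply]
  refine Finset.sum_eq_zero fun l _ => ?_
  by_cases h1 : (i, l) ∈ S
  · by_cases h2 : (l, j) ∈ S
    · exact absurd (hS i l j h1 h2) h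
    · rw [hB l j h2, mul_zero]
  · rw [hA i l h1, zero_mul]

variable (F)

/-- In a finite group every submonoid is closed under inverses. -/
theorem inv_mem_of_finite {G : Type*} [Group G] [Finite G] (S : Submonoid G) {g : G}
    (hg : g ∈ S) : g⁻¹ ∈ S := by
  have h : g⁻¹ ∈ Submonoid.powers g :=
    (isOfFinOrder_of_finite g).mem_powers_iff_mem_zpowers.2
      (Subgroup.inv_mem _ (Subgroup.mem_zpowers g))
  obtain ⟨e, he⟩ := h
  have he' : g ^ e = g⁻¹ := he
  rw [← he']
  exact S.pow_mem hg e

/-- The pattern subgroup `U_S = {E + A : supp A ⊆ S}` for a closed set `S`. -/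
def patternSubgroup [Finite F] (S : Finset (Fin m × Fin m)) (hS : ClosedRoots S) :
    Subgroup (GL (Fin m) F) :=
  let M : Submonoid (GL (Fin m) F) :=
    { carrier := {g | (g : Matrix (Fin m) (Fin m) F) - 1 ∈ suppSpace F S}
      one_mem' := by simp
      mul_mem' := by
        intro a b ha hb
        have h : ((a * b : GL (Fin m) F) : Matrix (Fin m) (Fin m) F) - 1
            = ((a : Matrix (Fin m) (Fin m) F) - 1) * ((b : Matrix (Fin m) (Fin m) F) - 1)
              + ((a : Matrix (Fin m) (Fin m) F) - 1) + ((b : Matrix (Fin m) (Fin m) F) - 1) := by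
          rw [Units.val_mul]
          noncomm_ring
        simp only [Set.mem_ofPred_eq]
        rw [h]
        exact add_mem (add_mem (mul_mem_suppSpace hS ha hb) ha) hb }
  { M with inv_mem' := fun hg => inv_mem_of_finite M hg }

theorem mem_patternSubgroup [Finite F] {S : Finset (Fin m × Fin m)} {hS : ClosedRoots S}
    {g : GL (Fin m) F} :
    g ∈ patternSubgroup F S hS ↔ (g : Matrix (Fin m) (Fin m) F) - 1 ∈ suppSpace F S := Iff.rfl

instance [Finite F] (S : Finset (Fin m × Fin m)) : Fintype (suppSpace F S) :=
  Fintype.ofFinite _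

variable {F}

/-- The root element `x_ij(α) = E + α e_ij` for `i ≠ j`. -/
def rootGL {i j : Fin m} (h : i ≠ j) (α : F) : GL (Fin m) F where
  val := 1 + Matrix.single i j α
  inv := 1 + Matrix.single i j (-α)
  val_inv := by
    have := Matrix.transvection_mul_transvection_same i j h α (-α)
    simpa [Matrix.transvection] using this
  inv_val := by
    have := Matrix.transvection_mul_transvection_same i j h (-α) α
    simpa [Matrix.transvection] using this

end Pattern

/-! ### The group `U_K = U_J ⋊ U_L` and its affine action on `V_J` -/

section Cocycle

variable {k : ℕ} {lam : Fin k → ℕ} (F : Type*) [Field F] [Finite F]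

/-- `U_K`. -/
abbrev groupK (s : Tableau lam) : Subgroup (GL (Idx lam) F) :=
  patternSubgroup F (setK s) (closed_setK s)

variable {F}

theorem rootGL_mem {s : Tableau lam} {i j : Idx lam} (h : (i, j) ∈ setK s) (α : F) :
    rootGL (mem_setK.1 h).1.ne' α ∈ groupK F s := by
  rw [mem_patternSubgroup]
  intro a b hab
  have : ¬ (i = a ∧ j = b) := by
    rintro ⟨rfl, rfl⟩
    exact hab h
  simp [rootGL, this]

/-- The root element `x_ij(α)`, `(i, j) ∈ K`, as an element of `U_K`. -/
def rootK {s : Tableau lam} {i j : Idx lam} (h : (i, j) ∈ setK s) (α : F) : groupK F s :=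
  ⟨rootGL (mem_setK.1 h).1.ne' α, rootGL_mem h α⟩

/-- The projection `ρ : U_K → U_L`, `ρ(u) = π_L(u - E) + E`, on the level of matrices. -/
def rho (s : Tableau lam) (u : groupK F s) : Matrix (Idx lam) (Idx lam) F :=
  proj (setL s) ((u : GL (Idx lam) F) - 1 : Matrix (Idx lam) (Idx lam) F) + 1

/-- The matrix underlying an element of `U_K`. -/
abbrev toMat {s : Tableau lam} (u : groupK F s) : Matrix (Idx lam) (Idx lam) F :=
  ((u : GL (Idx lam) F) : Matrix (Idx lam) (Idx lam) F)

theorem toMat_sub_one_mem {s : Tableau lam} (u : groupK F s) :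
    toMat u - 1 ∈ suppSpace F (setK s) := u.2

theorem proj_mul {s : Tableau lam} {A B : Matrix (Idx lam) (Idx lam) F}
    (hA : A ∈ suppSpace F (setK s)) (hB : B ∈ suppSpace F (setK s)) :
    proj (setL s) (A * B) = proj (setL s) A * proj (setL s) B := by
  ext i l
  simp only [proj, Matrix.of_apply, Matrix.mul_apply]
  split_ifs with h
  · refine Finset.sum_congr rfl fun j _ => ?_
    by_cases h1 : (i, j) ∈ setK s
    · by_cases h2 : (j, l) ∈ setK s
      · rw [mem_setK] at h1 h2
        rw [mem_setL] at h
        have e1 : row s i = row s j := le_antisymm (h.2.le.trans h2.2) h1.2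
        rw [if_pos (mem_setL.2 ⟨h1.1, e1⟩), if_pos (mem_setL.2 ⟨h2.1, e1 ▸ h.2⟩)]
      · rw [hB j l h2]
        simp
    · rw [hA i j h1]
      simp
  · symm
    refine Finset.sum_eq_zero fun j _ => ?_
    by_cases h1 : (i, j) ∈ setL s
    · by_cases h2 : (j, l) ∈ setL s
      · rw [mem_setL] at h1 h2
        exact absurd (mem_setL.2 ⟨h2.1.trans h1.1, h1.2.trans h2.2⟩) h
      · simp [h2]
    · simp [h1]

theorem proj_add (S : Finset (Idx lam × Idx lam)) (A B : Matrix (Idx lam) (Idx lam) F) :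
    proj S (A + B) = proj S A + proj S B := by
  ext i j
  by_cases h : (i, j) ∈ S <;> simp [proj, h]

theorem rho_mul (s : Tableau lam) (u v : groupK F s) : rho s (u * v) = rho s u * rho s v := by
  have h : toMat (u * v) - 1
      = (toMat u - 1) * (toMat v - 1) + (toMat u - 1) + (toMat v - 1) := by
    simp only [toMat, Subgroup.coe_mul, Units.val_mul]
    noncomm_ring
  simp only [rho]
  rw [show ((((u * v : groupK F s) : GL (Idx lam) F) : Matrix (Idx lam) (Idx lam) F) - 1) = _
    from h, proj_add, proj_add, proj_mul (toMat_sub_one_mem u) (toMat_sub_one_mem v)]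
  simp only [toMat]
  noncomm_ring

theorem rho_one (s : Tableau lam) : rho s (1 : groupK F s) = 1 := by
  ext i j
  simp [rho, proj]

theorem rho_sub_one_mem (s : Tableau lam) (u : groupK F s) :
    rho s u - 1 ∈ suppSpace F (setK s) := by
  intro i j h
  have h' : (i, j) ∉ setL s := fun h1 => h (setL_subset_setK s h1)
  simp [rho, proj, h']

/-- `V_J` is a two-sided ideal of `V_K`. -/
theorem mul_mem_J {s : Tableau lam} {A B : Matrix (Idx lam) (Idx lam) F}
    (h : (A ∈ suppSpace F (setK s) ∧ B ∈ suppSpace F (setJ s)) ∨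
      (A ∈ suppSpace F (setJ s) ∧ B ∈ suppSpace F (setK s))) :
    A * B ∈ suppSpace F (setJ s) := by
  intro i l hil
  rw [Matrix.mul_apply]
  refine Finset.sum_eq_zero fun j _ => ?_
  rcases h with ⟨hA, hB⟩ | ⟨hA, hB⟩
  · by_cases h1 : (i, j) ∈ setK s
    · by_cases h2 : (j, l) ∈ setJ s
      · rw [mem_setK] at h1
        rw [mem_setJ] at h2
        exact absurd (mem_setJ.2 ⟨h2.1.trans h1.1, h2.2.trans_le h1.2⟩) hil
      · rw [hB j l h2, mul_zero]
    · rw [hA i j h1, zero_mul]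
  · by_cases h1 : (i, j) ∈ setJ s
    · by_cases h2 : (j, l) ∈ setK s
      · rw [mem_setJ] at h1
        rw [mem_setK] at h2
        exact absurd (mem_setJ.2 ⟨h2.1.trans h1.1, h2.2.trans_lt h1.2⟩) hil
      · rw [hB j l h2, mul_zero]
    · rw [hA i j h1, zero_mul]

theorem act_mem (s : Tableau lam) (A : suppSpace F (setJ s)) (g : groupK F s) :
    rho s g⁻¹ * (A : Matrix (Idx lam) (Idx lam) F) * toMat g ∈ suppSpace F (setJ s) := by
  have h1 : rho s g⁻¹ * (A : Matrix (Idx lam) (Idx lam) F) ∈ suppSpace F (setJ s) := by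
    have : rho s g⁻¹ * (A : Matrix (Idx lam) (Idx lam) F)
        = (rho s g⁻¹ - 1) * (A : Matrix (Idx lam) (Idx lam) F) + A := by noncomm_ring
    rw [this]
    exact add_mem (mul_mem_J (Or.inl ⟨rho_sub_one_mem s _, A.2⟩)) A.2
  have : rho s g⁻¹ * (A : Matrix (Idx lam) (Idx lam) F) * toMat g
      = rho s g⁻¹ * (A : Matrix (Idx lam) (Idx lam) F) * (toMat g - 1)
        + rho s g⁻¹ * (A : Matrix (Idx lam) (Idx lam) F) := by noncomm_ring
  rw [this]
  exact add_mem (mul_mem_J (Or.inr ⟨h1, toMat_sub_one_mem g⟩)) h1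

/-- The linear action `A ∘ g = ρ(g⁻¹) A g` of `U_K` on `V_J`. -/
def circ (s : Tableau lam) (A : suppSpace F (setJ s)) (g : groupK F s) : suppSpace F (setJ s) :=
  ⟨rho s g⁻¹ * (A : Matrix (Idx lam) (Idx lam) F) * toMat g, act_mem s A g⟩

theorem cocycle_mem (s : Tableau lam) (g : groupK F s) :
    rho s g⁻¹ * toMat g - 1 ∈ suppSpace F (setJ s) := by
  intro i j hij
  have e : rho s g⁻¹ * toMat g - 1
      = rho s g⁻¹ * (toMat g - rho s g) := by
    rw [mul_sub, ← rho_mul, inv_mul_cancel, rho_one]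
  have hm : toMat g - rho s g ∈ suppSpace F (setJ s) := by
    intro a b hab
    by_cases hL : (a, b) ∈ setL s
    · simp [rho, proj, hL, toMat]
    · have hK : (a, b) ∉ setK s := by
        intro hK
        rw [mem_setK] at hK
        rw [mem_setJ] at hab
        rw [mem_setL] at hL
        rcases lt_or_eq_of_le hK.2 with h | h
        · exact hab ⟨hK.1, h⟩
        · exact hL ⟨hK.1, h.symm⟩
      have := toMat_sub_one_mem g a b hK
      simp only [Matrix.sub_apply] at this
      simp [rho, proj, hL, toMat, this]
  have e2 : rho s g⁻¹ * (toMat g - rho s g)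
      = (rho s g⁻¹ - 1) * (toMat g - rho s g) + (toMat g - rho s g) := by noncomm_ring
  have := add_mem (mul_mem_J (Or.inl ⟨rho_sub_one_mem s g⁻¹, hm⟩)) hm
  rw [← e2, ← e] at this
  exact this i j hij

/-- The 1-cocycle `f(g) = ρ(g⁻¹) g - E` from `U_K` to `V_J`. -/
def cocycle (s : Tableau lam) (g : groupK F s) : suppSpace F (setJ s) :=
  ⟨rho s g⁻¹ * toMat g - 1, cocycle_mem s g⟩

theorem circ_mul (s : Tableau lam) (A : suppSpace F (setJ s)) (g h : groupK F s) :
    circ s A (g * h) = circ s (circ s A g) h := by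
  ext1
  simp only [circ, mul_inv_rev, rho_mul, toMat, Subgroup.coe_mul, Units.val_mul]
  simp only [mul_assoc]

theorem circ_one (s : Tableau lam) (A : suppSpace F (setJ s)) : circ s A 1 = A := by
  ext1
  simp [circ, rho_one, toMat]

theorem circ_add (s : Tableau lam) (A B : suppSpace F (setJ s)) (g : groupK F s) :
    circ s (A + B) g = circ s A g + circ s B g := by
  ext1
  simp [circ, mul_add, add_mul]

theorem cocycle_mul (s : Tableau lam) (x g : groupK F s) :
    cocycle s (x * g) = circ s (cocycle s x) g + cocycle s g := by
  ext1
  simp only [cocycle, circ, mul_inv_rev, rho_mul, toMat, Subgroup.coe_mul, Units.val_mul,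
    Submodule.coe_add]
  noncomm_ring

theorem cocycle_one (s : Tableau lam) : cocycle s (1 : groupK F s) = 0 := by
  ext1
  simp [cocycle, rho_one, toMat]

/-- The affine action of `U_K` on `V_J` given by the cocycle. -/
def affine (s : Tableau lam) (g : groupK F s) (A : suppSpace F (setJ s)) : suppSpace F (setJ s) :=
  circ s A g + cocycle s g

theorem affine_mul (s : Tableau lam) (g h : groupK F s) (A : suppSpace F (setJ s)) :
    affine s (g * h) A = affine s h (affine s g A) := by
  simp only [affine, circ_mul, cocycle_mul, circ_add]
  abel

theorem affine_one (s : Tableau lam) (A : suppSpace F (setJ s)) : affine s 1 A = A := by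
  simp [affine, circ_one, cocycle_one]

/-- The right action of `U_K` on the group algebra `ℂ(V_J, +)`, written as a representation of the
opposite group. Regarding elements of the group algebra as functions on `V_J`, it is
`(τ g)(v) = τ(v ∘ g⁻¹ + f(g⁻¹))`; on linear characters `χ` of `V_J` it is the monomial action
`χ g = χ(f(g⁻¹)) χ.g` with `(χ.g)(v) = χ(v ∘ g⁻¹)`. Both are proved below. -/
def actionV (s : Tableau lam) :
    Representation ℂ (groupK F s)ᵐᵒᵖ (AddMonoidAlgebra ℂ (suppSpace F (setJ s))) where
  toFun g := AddMonoidAlgebra.mapDomainLinearMap ℂ ℂ (affine s g.unop)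
  map_one' := by
    ext A : 2
    simp [affine_one]
  map_mul' g h := by
    ext A : 2
    simp [affine_mul]

theorem coeff_actionV (s : Tableau lam) (g : groupK F s)
    (τ : AddMonoidAlgebra ℂ (suppSpace F (setJ s))) (v : suppSpace F (setJ s)) :
    (actionV s (MulOpposite.op g) τ).coeff v = τ.coeff (circ s v g⁻¹ + cocycle s g⁻¹) := by
  have h1 : ∀ A, affine s g (affine s g⁻¹ A) = A := fun A => by
    rw [← affine_mul, inv_mul_cancel, affine_one]
  have hinj : Function.Injective (affine s g) := fun A B hAB => by
    have := congrArg (affine s g⁻¹) hAB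
    rwa [← affine_mul, ← affine_mul, mul_inv_cancel, affine_one, affine_one] at this
  change (Finsupp.mapDomain (affine s g) τ.coeff) v = τ.coeff (affine s g⁻¹ v)
  conv_lhs => rw [← h1 v]
  exact Finsupp.mapDomain_apply hinj _ _

/-- The monomial action on linear characters. -/
theorem actionV_char (s : Tableau lam) (g : groupK F s) (χ : AddChar (suppSpace F (setJ s)) ℂ) :
    actionV s (MulOpposite.op g) (∑ v, AddMonoidAlgebra.single v (χ v))
      = χ (cocycle s g⁻¹) • ∑ v, AddMonoidAlgebra.single v (χ (circ s v g⁻¹)) := by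
  classical
  ext v
  rw [coeff_actionV]
  simp [AddMonoidAlgebra.coeff_sum, Finsupp.finsetSum_apply, Finsupp.single_apply,
    AddChar.map_add_eq_mul, mul_comm]

/-! ### Lidempotents -/

/-- `χ_A : V_J → ℂ*`, `χ_A(B) = θ(∑_{(i,j) ∈ J} A_ij B_ij)`. -/
def chi (θ : AddChar F ℂ) (s : Tableau lam) (A B : suppSpace F (setJ s)) : ℂ :=
  θ (∑ p ∈ setJ s, (A : Matrix (Idx lam) (Idx lam) F) p.1 p.2
    * (B : Matrix (Idx lam) (Idx lam) F) p.1 p.2)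

/-- The lidempotent `e_A = q^{-|J|} ∑_{B ∈ V_J} conj(χ_A(B)) B` in `ℂ(V_J, +)`. -/
def lidem (θ : AddChar F ℂ) (s : Tableau lam) (A : suppSpace F (setJ s)) :
    AddMonoidAlgebra ℂ (suppSpace F (setJ s)) :=
  ((Nat.card F : ℂ) ^ (setJ s).card)⁻¹ •
    ∑ B, AddMonoidAlgebra.single B ((starRingEnd ℂ) (chi θ s A B))

/-! ### Transport to matrices with reordered rows -/

variable (F)

/-- The permutation matrix of `w`, with rows `e_i w = e_{iw}`. -/
abbrev permMat (w : Equiv.Perm (Idx lam)) : Matrix (Idx lam) (Idx lam) F :=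
  w.permMatrix F

theorem permMat_mul_apply (w : Equiv.Perm (Idx lam)) (A : Matrix (Idx lam) (Idx lam) F)
    (a b : Idx lam) : (permMat F w * A) a b = A (w a) b := by
  simp [permMat, Equiv.Perm.permMatrix, PEquiv.toMatrix_toPEquiv_mul]

theorem permMat_mul_injective (w : Equiv.Perm (Idx lam)) :
    Function.Injective (LinearMap.mulLeft F (permMat F w)) := by
  intro A B h
  ext a b
  have := congrFun (congrFun h (w.symm a)) b
  simpa [permMat_mul_apply] using this

/-- `𝔛_s⁰ = {dA : A ∈ V_J} = {du - d : u ∈ U_J}`. -/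
def X0 (s : Tableau lam) : Submodule F (Matrix (Idx lam) (Idx lam) F) :=
  (suppSpace F (setJ s)).map (LinearMap.mulLeft F (permMat F (dperm s)))

variable {F}

/-- The linear isomorphism `A ↦ dA` from `V_J` onto `𝔛_s⁰`. -/
def dmul (s : Tableau lam) : suppSpace F (setJ s) ≃ₗ[F] X0 F s :=
  Submodule.equivMapOfInjective _ (permMat_mul_injective F (dperm s)) _

theorem dmul_coe (s : Tableau lam) (A : suppSpace F (setJ s)) :
    (dmul s A : Matrix (Idx lam) (Idx lam) F)
      = permMat F (dperm s) * (A : Matrix (Idx lam) (Idx lam) F) := rfl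

/-- The isomorphism of group algebras `ℂ(V_J, +) → ℂ(𝔛_s⁰, +)` extending `A ↦ dA`. -/
def transport (s : Tableau lam) :
    AddMonoidAlgebra ℂ (suppSpace F (setJ s)) ≃ₐ[ℂ] AddMonoidAlgebra ℂ (X0 F s) :=
  AddMonoidAlgebra.domCongr ℂ ℂ (dmul s).toAddEquiv

/-- The lidempotent `e_X` for `X = dA ∈ 𝔛_s⁰`, the image of `e_A` under `transport`. -/
def lidemX (θ : AddChar F ℂ) (s : Tableau lam) (X : X0 F s) : AddMonoidAlgebra ℂ (X0 F s) :=
  transport s (lidem θ s ((dmul s).symm X))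

/-- The right action of `U_K` on `ℂ(𝔛_s⁰, +)` transported from `ℂ(V_J, +)`. -/
def actionX (s : Tableau lam) :
    Representation ℂ (groupK F s)ᵐᵒᵖ (AddMonoidAlgebra ℂ (X0 F s)) :=
  ((transport s).toLinearEquiv.conjAlgEquiv ℂ).toAlgHom.toRingHom.toMonoidHom.comp (actionV s)

theorem actionX_transport (s : Tableau lam) (g : groupK F s)
    (x : AddMonoidAlgebra ℂ (suppSpace F (setJ s))) :
    actionX s (MulOpposite.op g) (transport s x)
      = transport s (actionV s (MulOpposite.op g) x) := by
  simp [actionX]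

/-! ### Truncated operations on matrices with relabelled rows

The `a`-th row (from the top) of a matrix `dA` carries the label `a d`, that is `dperm s a`; so the
row with label `i` is the row with index `(dperm s).symm i`, and its entry in column `j`
is `A i j`. -/

/-- Add `c` times column `j` to column `i`. -/
def addCol (j i : Idx lam) (c : F) (X : Matrix (Idx lam) (Idx lam) F) :
    Matrix (Idx lam) (Idx lam) F :=
  X.updateCol i fun a => X a i + c * X a j

/-- Add `c` times the row labelled `i` to the row labelled `j`. -/
def addRow (s : Tableau lam) (i j : Idx lam) (c : F) (X : Matrix (Idx lam) (Idx lam) F) :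
    Matrix (Idx lam) (Idx lam) F :=
  X.updateRow ((dperm s).symm j) fun b =>
    X ((dperm s).symm j) b + c * X ((dperm s).symm i) b

/-- Set to zero every entry whose position (row label, column) does not belong to `J`. -/
def truncX (s : Tableau lam) (X : Matrix (Idx lam) (Idx lam) F) : X0 F s :=
  ⟨Matrix.of fun a b => if (dperm s a, b) ∈ setJ s then X a b else 0, by
    refine ⟨proj (setJ s) (Matrix.of fun i j => X ((dperm s).symm i) j), proj_mem _ _, ?_⟩
    ext a b
    simp [permMat_mul_apply, proj]⟩

/-! ### The `s`-component of `M(lam)` -/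

/-- The standard parabolic subgroup `P_lam`: the invertible matrices which are block upper
triangular for the composition `lam`. Equivalently, the stabilizer of the standard `lam`-flag. -/
def parabolic (F : Type*) [Field F] [Finite F] (lam : Fin k → ℕ) : Subgroup (GL (Idx lam) F) :=
  let M : Submonoid (GL (Idx lam) F) :=
    { carrier := {g | ∀ a b, row (initial lam) b < row (initial lam) a →
        (g : Matrix (Idx lam) (Idx lam) F) a b = 0}
      one_mem' := by
        intro a b h
        have : a ≠ b := by
          rintro rfl
          exact lt_irrefl _ h
        simp [this]
      mul_mem' := by
        intro g h hg hh a b hab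
        rw [Units.val_mul, Matrix.mul_apply]
        refine Finset.sum_eq_zero fun c _ => ?_
        rcases lt_or_ge (row (initial lam) c) (row (initial lam) a) with h1 | h1
        · rw [hg a c h1, zero_mul]
        · rw [hh c b (hab.trans_le h1), mul_zero] }
  { M with inv_mem' := fun hg => inv_mem_of_finite M hg }

instance : Fintype (parabolic F lam) := Fintype.ofFinite _

variable (F) in
/-- `∑_{h ∈ P_lam} h` in `ℂ GL_n(q)`. -/
def parabolicSum (lam : Fin k → ℕ) : MonoidAlgebra ℂ (GL (Idx lam) F) :=
  ∑ h : parabolic F lam, MonoidAlgebra.single (h : GL (Idx lam) F) 1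

theorem det_permMat_ne_zero (w : Equiv.Perm (Idx lam)) : (permMat F w).det ≠ 0 := by
  rw [permMat, Matrix.det_permutation]
  rcases Int.units_eq_one_or w.sign with h | h <;> simp [h]

/-- The permutation matrix of `w` as an element of `GL_n(q)`. -/
def permGL (w : Equiv.Perm (Idx lam)) : GL (Idx lam) F :=
  Matrix.GeneralLinearGroup.mkOfDetNeZero (permMat F w) (det_permMat_ne_zero w)

theorem det_add_ne_zero {s : Tableau lam} (X : X0 F s) :
    ((X : Matrix (Idx lam) (Idx lam) F) + permMat F (dperm s)).det ≠ 0 := by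
  obtain ⟨_, A, hA, rfl⟩ := X
  have e : LinearMap.mulLeft F (permMat F (dperm s)) A + permMat F (dperm s)
      = permMat F (dperm s) * (A + 1) := by
    simp [mul_add]
  have hz : ∀ i j : Idx lam, i ≤ j → A i j = 0 := fun i j hij =>
    hA i j fun h => absurd (mem_setJ.1 h).1 (not_lt.2 hij)
  have hd : (A + 1).det = 1 := by
    rw [Matrix.det_of_isLowerTriangular]
    · simp [hz]
    · intro i j hij
      have hij' : i < j := hij
      simp [hz i j hij'.le, hij'.ne]
  simp only
  rw [e, Matrix.det_mul, hd, mul_one]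
  exact det_permMat_ne_zero _

/-- For `X = du - d ∈ 𝔛_s⁰`, `u ∈ U_J`, the matrix `du = X + d ∈ 𝔛_s` in `GL_n(q)`. -/
def addD (s : Tableau lam) (X : X0 F s) : GL (Idx lam) F :=
  Matrix.GeneralLinearGroup.mkOfDetNeZero _ (det_add_ne_zero X)

variable (F) in
/-- The `s`-component `M_s`: the `ℂ`-span in `ℂ GL_n(q)` of all `P̄_lam d u`, `u ∈ U`, where `U` is
the group of lower unitriangular matrices and `P̄_lam` is the sum of all elements of `P_lam`. -/
def compM (s : Tableau lam) : Submodule ℂ (MonoidAlgebra ℂ (GL (Idx lam) F)) :=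
  Submodule.span ℂ (Set.range fun u : patternSubgroup F (negRoots lam) (closed_negRoots lam) =>
    parabolicSum F lam * MonoidAlgebra.single (permGL (dperm s) * (u : GL (Idx lam) F)) 1)

variable (F) in
/-- The linear map `ℂ(𝔛_s⁰, +) → ℂ GL_n(q)` with `du - d ↦ P̄_lam du` for `u ∈ U_J`. -/
def toCompM (s : Tableau lam) :
    AddMonoidAlgebra ℂ (X0 F s) →ₗ[ℂ] MonoidAlgebra ℂ (GL (Idx lam) F) :=
  (Finsupp.lsum ℂ fun X : X0 F s => LinearMap.toSpanSingleton ℂ _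
      (parabolicSum F lam * MonoidAlgebra.single (addD s X) 1)) ∘ₗ
    (AddMonoidAlgebra.coeffLinearEquiv ℂ).toLinearMap

theorem toCompM_single (s : Tableau lam) (X : X0 F s) :
    toCompM F s (AddMonoidAlgebra.single X 1)
      = parabolicSum F lam * MonoidAlgebra.single (addD s X) 1 := by
  simp [toCompM]

end Cocycle

end SComp

end

/-! Two observations carry the proof. On the character side, the coefficient function of `lidem θ s
A` is, up to the scalar `q^{-|J|}`, the linear character `χ̄_A` of `V_J`. Since `θ` is nontrivial,
distinct `A` give distinct characters, so Dedekind's independence of characters and a dimension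
count make the `e_{dA}` a basis. Since `χ_A` is given by the trace form `tr(Aᵀ B)`, the action of
`g` can be moved to the index: `A` becomes the truncation of `ρ(g)ᵀ A g⁻ᵀ`, with the scalar
`χ̄_A(f(g⁻¹))` (`actionV_lidem`). For a root element, `g⁻ᵀ` on the right is a column operation and
`ρ(g)ᵀ` on the left a row operation. For a root in `J` the factor `ρ(g)` is trivial, and for a root
in `L` the cocycle vanishes.

On the group side, `P̄_λ d` absorbs every `w` with `d w d⁻¹ ∈ P_λ`, that is, every `w` with zero
entries wherever `row i > row j`. Both `U_{J^c}` and the values of `ρ` consist of such `w`, while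
`U_J` meets them trivially. Hence the cosets `P_λ du`, `u ∈ U_J`, are disjoint (injectivity), the
factorization `U = U_{J^c} U_J` shows that they span `M_s` (surjectivity), and the affine action `u
↦ ρ(g⁻¹) u g` becomes right multiplication by `g` (equivariance). -/

namespace SComp

/-! ### Linear characters of `V_J` and the basis of lidempotents. -/

section Lidempotents

open Matrix

variable {k : ℕ} {lam : Fin k → ℕ} {F : Type*} [Field F]

theorem proj_of_mem {m : ℕ} {S : Finset (Fin m × Fin m)} {A : Matrix (Fin m) (Fin m) F}
    (hA : A ∈ suppSpace F S) : proj S A = A := by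
  ext i j
  by_cases h : (i, j) ∈ S
  · simp [proj, h]
  · simp [proj, h, hA i j h]

theorem single_mem_suppSpace {m : ℕ} {S : Finset (Fin m × Fin m)} {i j : Fin m}
    (h : (i, j) ∈ S) (c : F) : Matrix.single i j c ∈ suppSpace F S := by
  intro a b hab
  have : ¬ (i = a ∧ j = b) := by
    rintro ⟨rfl, rfl⟩
    exact hab h
  simp [this]

/-- The trace form `(A, B) ↦ tr (Aᵀ B)` is the sum of the products of the entries. -/
theorem trace_transpose_mul_eq_sum {m : ℕ} {S : Finset (Fin m × Fin m)}
    (A : Matrix (Fin m) (Fin m) F) {B : Matrix (Fin m) (Fin m) F} (hB : B ∈ suppSpace F S) :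
    (Aᵀ * B).trace = ∑ p ∈ S, A p.1 p.2 * B p.1 p.2 := by
  have h : ∑ p ∈ S, A p.1 p.2 * B p.1 p.2 = ∑ p : Fin m × Fin m, A p.1 p.2 * B p.1 p.2 := by
    refine Finset.sum_subset (Finset.subset_univ _) fun p _ hp => ?_
    rw [hB p.1 p.2 hp, mul_zero]
  rw [h, Fintype.sum_prod_type, Finset.sum_comm]
  simp [Matrix.trace, Matrix.mul_apply]

/-- The entries removed by truncation are paired only with zeros of `B`. This is the source of the
truncation in all four formulas: only the restriction of the trace form to `V_J` is visible. -/
theorem trace_proj_transpose_mul {m : ℕ} {S : Finset (Fin m × Fin m)}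
    (A : Matrix (Fin m) (Fin m) F) {B : Matrix (Fin m) (Fin m) F} (hB : B ∈ suppSpace F S) :
    ((proj S A)ᵀ * B).trace = (Aᵀ * B).trace := by
  rw [trace_transpose_mul_eq_sum _ hB, trace_transpose_mul_eq_sum _ hB]
  refine Finset.sum_congr rfl fun p hp => ?_
  simp [proj, hp]

variable [Finite F]

theorem chi_eq_trace (θ : AddChar F ℂ) (s : Tableau lam) (A B : suppSpace F (setJ s)) :
    chi θ s A B = θ (((A : Matrix (Idx lam) (Idx lam) F)ᵀ * (B : Matrix _ _ F)).trace) := by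
  rw [trace_transpose_mul_eq_sum _ B.2, chi]

/-- The linear character `χ̄_A` of `V_J`. -/
def conjChi (θ : AddChar F ℂ) (s : Tableau lam) (A : suppSpace F (setJ s)) :
    AddChar (suppSpace F (setJ s)) ℂ where
  toFun B := (starRingEnd ℂ) (chi θ s A B)
  map_zero_eq_one' := by simp [chi_eq_trace]
  map_add_eq_mul' B C := by
    simp [chi_eq_trace, Matrix.mul_add, AddChar.map_add_eq_mul]

/-- At a position where `A` and `A'` differ by `c ≠ 0`, the matrix with the single entry `c⁻¹ x`,
where `θ x ≠ 1`, separates the two characters: the values differ by the factor `θ x`. -/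
theorem conjChi_injective {θ : AddChar F ℂ} (hθ : θ ≠ 1) (s : Tableau lam) :
    Function.Injective (conjChi θ s) := by
  intro A A' h
  by_contra hne
  obtain ⟨i, j, hij⟩ : ∃ i j, (A : Matrix (Idx lam) (Idx lam) F) i j
      ≠ (A' : Matrix (Idx lam) (Idx lam) F) i j := by
    by_contra! hall
    exact hne (Subtype.ext (Matrix.ext hall))
  have hJ : (i, j) ∈ setJ s := by
    by_contra hJ
    exact hij ((A.2 i j hJ).trans (A'.2 i j hJ).symm)
  obtain ⟨x, hx⟩ := (AddChar.ne_one_iff).1 hθ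
  set c := (A : Matrix (Idx lam) (Idx lam) F) i j - (A' : Matrix (Idx lam) (Idx lam) F) i j
  have hc : c ≠ 0 := sub_ne_zero.2 hij
  have h1 := DFunLike.congr_fun h ⟨Matrix.single i j (c⁻¹ * x), single_mem_suppSpace hJ _⟩
  have h2 : θ ((A : Matrix (Idx lam) (Idx lam) F) i j * (c⁻¹ * x))
      = θ ((A' : Matrix (Idx lam) (Idx lam) F) i j * (c⁻¹ * x)) := by
    have := (starRingEnd ℂ).injective h1
    simpa [chi_eq_trace, Matrix.trace_mul_comm _ (Matrix.single _ _ _),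
      Matrix.trace_single_mul, mul_comm, mul_assoc, mul_left_comm] using this
  apply hx
  have h3 : (A : Matrix (Idx lam) (Idx lam) F) i j * (c⁻¹ * x)
      = (A' : Matrix (Idx lam) (Idx lam) F) i j * (c⁻¹ * x) + x := by
    have : c * (c⁻¹ * x) = x := mul_inv_cancel_left₀ hc x
    rw [← sub_eq_iff_eq_add', ← sub_mul]
    exact this
  rw [h3, AddChar.map_add_eq_mul] at h2
  have hne0 := θ.val_isUnit ((A' : Matrix (Idx lam) (Idx lam) F) i j * (c⁻¹ * x)) |>.ne_zero
  exact mul_left_cancel₀ hne0 (h2.trans (mul_one _).symm)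

theorem coeff_lidem (θ : AddChar F ℂ) (s : Tableau lam) (A v : suppSpace F (setJ s)) :
    (lidem θ s A).coeff v = ((Nat.card F : ℂ) ^ (setJ s).card)⁻¹ * conjChi θ s A v := by
  classical
  simp [lidem, conjChi, AddMonoidAlgebra.coeff_sum, Finsupp.single_apply]

theorem linearIndependent_lidem {θ : AddChar F ℂ} (hθ : θ ≠ 1) (s : Tableau lam) :
    LinearIndependent ℂ (lidem θ s) := by
  have hq : ((Nat.card F : ℂ) ^ (setJ s).card) ≠ 0 := by
    simp [Nat.card_pos.ne']
  -- Reading elements as functions and rescaling by `q^{|J|}` turns `e_A` into `χ̄_A` exactly, so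
  -- that independence of characters applies.
  let T : AddMonoidAlgebra ℂ (suppSpace F (setJ s)) →ₗ[ℂ] (suppSpace F (setJ s) → ℂ) :=
    ((Nat.card F : ℂ) ^ (setJ s).card) •
      (Finsupp.lcoeFun ∘ₗ (AddMonoidAlgebra.coeffLinearEquiv ℂ).toLinearMap)
  refine LinearIndependent.of_comp T ?_
  have hT : T ∘ lidem θ s = (fun ψ : AddChar (suppSpace F (setJ s)) ℂ => ⇑ψ) ∘ conjChi θ s := by
    funext A v
    have : (T ∘ lidem θ s) A v
        = ((Nat.card F : ℂ) ^ (setJ s).card) * (lidem θ s A).coeff v := rfl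
    rw [this, coeff_lidem, mul_inv_cancel_left₀ hq]
    rfl
  rw [hT]
  exact (AddChar.linearIndependent _ ℂ).comp _ (conjChi_injective hθ s)

theorem lidemX_dmul (θ : AddChar F ℂ) (s : Tableau lam) (A : suppSpace F (setJ s)) :
    lidemX θ s (dmul s A) = transport s (lidem θ s A) := by
  simp [lidemX]

theorem linearIndependent_lidemX {θ : AddChar F ℂ} (hθ : θ ≠ 1) (s : Tableau lam) :
    LinearIndependent ℂ fun A : suppSpace F (setJ s) => lidemX θ s (dmul s A) := by
  simp only [lidemX_dmul]
  exact (linearIndependent_lidem hθ s).map' (transport s).toLinearMap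
    (LinearMap.ker_eq_bot_of_injective (transport s).injective)

theorem span_lidemX_eq_top {θ : AddChar F ℂ} (hθ : θ ≠ 1) (s : Tableau lam) :
    Submodule.span ℂ (Set.range fun A : suppSpace F (setJ s) => lidemX θ s (dmul s A)) = ⊤ := by
  -- Used only to see that the dimension is `|V_J|`, the number of lidempotents.
  have e : AddMonoidAlgebra ℂ (X0 F s) ≃ₗ[ℂ] (suppSpace F (setJ s) →₀ ℂ) :=
    (transport s).symm.toLinearEquiv.trans (AddMonoidAlgebra.coeffLinearEquiv ℂ)
  have : FiniteDimensional ℂ (AddMonoidAlgebra ℂ (X0 F s)) :=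
    Module.Finite.equiv e.symm
  refine (linearIndependent_lidemX hθ s).span_eq_top_of_card_eq_finrank ?_
  rw [e.finrank_eq, Module.finrank_finsupp_self]

/-! ### The monomial action, moved from characters to their indices. -/

/-- The monomial action of `U_K` on lidempotents. -/
theorem actionV_lidem (θ : AddChar F ℂ) (s : Tableau lam) (g : groupK F s)
    (A : suppSpace F (setJ s)) :
    actionV s (MulOpposite.op g) (lidem θ s A)
      = conjChi θ s A (cocycle s g⁻¹) •
        lidem θ s ⟨proj (setJ s) ((rho s g)ᵀ * (A : Matrix _ _ F) * (toMat g⁻¹)ᵀ),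
          proj_mem _ _⟩ := by
  ext v
  -- Adjointness for the trace form: `tr(Aᵀ ρ(g) v g⁻¹) = tr((ρ(g)ᵀ A g⁻ᵀ)ᵀ v)`, and truncating the
  -- index is harmless because `v ∈ V_J`.
  have h : conjChi θ s A (circ s v g⁻¹) = conjChi θ s
      ⟨proj (setJ s) ((rho s g)ᵀ * (A : Matrix _ _ F) * (toMat g⁻¹)ᵀ), proj_mem _ _⟩ v := by
    have hc : (circ s v g⁻¹ : Matrix (Idx lam) (Idx lam) F)
        = rho s g * (v : Matrix _ _ F) * toMat g⁻¹ := by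
      simp only [circ, inv_inv]
    change (starRingEnd ℂ) (chi θ s A _) = (starRingEnd ℂ) (chi θ s _ v)
    rw [chi_eq_trace, chi_eq_trace, trace_proj_transpose_mul _ v.2, hc]
    congr 2
    simp only [Matrix.transpose_mul, Matrix.transpose_transpose]
    rw [← Matrix.mul_assoc, Matrix.trace_mul_comm]
    simp only [Matrix.mul_assoc]
  rw [coeff_actionV, coeff_lidem, AddChar.map_add_eq_mul, h, AddMonoidAlgebra.coeff_smul,
    Finsupp.smul_apply, coeff_lidem, smul_eq_mul]
  ring

theorem actionX_lidemX (θ : AddChar F ℂ) (s : Tableau lam) (g : groupK F s)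
    (A : suppSpace F (setJ s)) :
    actionX s (MulOpposite.op g) (lidemX θ s (dmul s A))
      = conjChi θ s A (cocycle s g⁻¹) •
        lidemX θ s (truncX s (permMat F (dperm s) *
          ((rho s g)ᵀ * (A : Matrix _ _ F) * (toMat g⁻¹)ᵀ))) := by
  rw [lidemX_dmul, actionX_transport, actionV_lidem, map_smul, ← lidemX_dmul]
  congr 2
  ext a b
  simp [dmul_coe, permMat_mul_apply, proj, truncX]

/-! ### Row and column operations as multiplications; root elements. -/

theorem addCol_permMat_mul (s : Tableau lam) (i j : Idx lam) (c : F)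
    (A : Matrix (Idx lam) (Idx lam) F) :
    addCol j i c (permMat F (dperm s) * A)
      = permMat F (dperm s) * (A * (1 + Matrix.single j i c)) := by
  ext a b
  rw [permMat_mul_apply, Matrix.mul_add, Matrix.mul_one, Matrix.add_apply]
  by_cases h : b = i
  · subst h
    simp [addCol, permMat_mul_apply, mul_comm]
  · simp [addCol, permMat_mul_apply, h]

/-- Labelling the rows through `d` makes the operation on `dA` a left multiplication of `A` itself.
The factor is the transpose of `x_ij(c)`, which is the shape of `ρ(g)ᵀ`. -/
theorem addRow_permMat_mul (s : Tableau lam) (i j : Idx lam) (c : F)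
    (A : Matrix (Idx lam) (Idx lam) F) :
    addRow s i j c (permMat F (dperm s) * A)
      = permMat F (dperm s) * ((1 + Matrix.single j i c) * A) := by
  ext a b
  rw [permMat_mul_apply, Matrix.add_mul, Matrix.one_mul, Matrix.add_apply]
  by_cases h : a = (dperm s).symm j
  · subst h
    simp [addRow, permMat_mul_apply]
  · have h' : dperm s a ≠ j := fun e => h (by simp [← e])
    simp [addRow, permMat_mul_apply, h, h']

theorem toMat_rootK {s : Tableau lam} {i j : Idx lam} (h : (i, j) ∈ setK s) (α : F) :
    toMat (rootK h α) = 1 + Matrix.single i j α := rfl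

theorem toMat_rootK_inv {s : Tableau lam} {i j : Idx lam} (h : (i, j) ∈ setK s) (α : F) :
    toMat (rootK h α)⁻¹ = 1 + Matrix.single i j (-α) := rfl

theorem rho_rootK_of_mem_setJ {s : Tableau lam} {i j : Idx lam} (h : (i, j) ∈ setK s)
    (hJ : (i, j) ∈ setJ s) (α : F) : rho s (rootK h α) = 1 := by
  have hL : (i, j) ∉ setL s := fun hL => (mem_setJ.1 hJ).2.ne (mem_setL.1 hL).2.symm
  have e : toMat (rootK h α) - 1 = Matrix.single i j α := by rw [toMat_rootK, add_sub_cancel_left]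
  change proj (setL s) (toMat (rootK h α) - 1) + 1 = 1
  rw [e, add_eq_right]
  ext a b
  by_cases hab : (a, b) ∈ setL s
  · have : ¬ (i = a ∧ j = b) := by
      rintro ⟨rfl, rfl⟩
      exact hL hab
    simp [proj, this]
  · simp [proj, hab]

theorem rho_rootK_of_mem_setL {s : Tableau lam} {i j : Idx lam} (h : (i, j) ∈ setK s)
    (hL : (i, j) ∈ setL s) (α : F) : rho s (rootK h α) = 1 + Matrix.single i j α := by
  have e : toMat (rootK h α) - 1 = Matrix.single i j α := by rw [toMat_rootK, add_sub_cancel_left]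
  change proj (setL s) (toMat (rootK h α) - 1) + 1 = _
  rw [e, proj_of_mem (single_mem_suppSpace hL α), add_comm]

theorem rootK_inv {s : Tableau lam} {i j : Idx lam} (h : (i, j) ∈ setK s) (α : F) :
    (rootK h α)⁻¹ = rootK h (-α) := by
  ext1
  exact Units.ext rfl

theorem cocycle_rootK_of_mem_setJ {s : Tableau lam} {i j : Idx lam} (h : (i, j) ∈ setK s)
    (hJ : (i, j) ∈ setJ s) (α : F) :
    (cocycle s (rootK h α) : Matrix (Idx lam) (Idx lam) F) = Matrix.single i j α := by
  change rho s (rootK h α)⁻¹ * toMat (rootK h α) - 1 = _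
  rw [rootK_inv, rho_rootK_of_mem_setJ h hJ, toMat_rootK, Matrix.one_mul, add_sub_cancel_left]

/-- Here `ρ` fixes the root element, so `ρ(g⁻¹) g = E`; hence no scalar appears for roots in `L`. -/
theorem cocycle_rootK_of_mem_setL {s : Tableau lam} {i j : Idx lam} (h : (i, j) ∈ setK s)
    (hL : (i, j) ∈ setL s) (α : F) : cocycle s (rootK h α) = 0 := by
  ext1
  change rho s (rootK h α)⁻¹ * toMat (rootK h α) - 1 = 0
  rw [rootK_inv, rho_rootK_of_mem_setL h hL, ← toMat_rootK h, ← rootK_inv, sub_eq_zero]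
  exact Units.inv_mul (rootK h α : GL (Idx lam) F)

theorem actionX_rootK_of_mem_setJ (θ : AddChar F ℂ) {s : Tableau lam} {i j : Idx lam}
    (hK : (i, j) ∈ setK s) (hJ : (i, j) ∈ setJ s) (α : F) (A : suppSpace F (setJ s)) :
    actionX s (MulOpposite.op (rootK hK α)) (lidemX θ s (dmul s A))
      = θ ((A : Matrix (Idx lam) (Idx lam) F) i j * α) •
        lidemX θ s (truncX s (addCol j i (-α) (dmul s A))) := by
  rw [actionX_lidemX, dmul_coe, addCol_permMat_mul, toMat_rootK_inv, rho_rootK_of_mem_setJ hK hJ]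
  congr 1
  -- The cocycle at the inverse root element is `-α e_ij`; its sign cancels against the complex
  -- conjugation, leaving `θ(A_ij α)`.
  · change (starRingEnd ℂ) (chi θ s A _) = _
    rw [chi_eq_trace, rootK_inv, cocycle_rootK_of_mem_setJ hK hJ, Matrix.trace_mul_comm,
      Matrix.trace_single_mul, ← AddChar.map_neg_eq_conj]
    simp [mul_comm]
  · simp

theorem actionX_rootK_of_mem_setL (θ : AddChar F ℂ) {s : Tableau lam} {i j : Idx lam}
    (hK : (i, j) ∈ setK s) (hL : (i, j) ∈ setL s) (α : F) (A : suppSpace F (setJ s)) :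
    actionX s (MulOpposite.op (rootK hK α)) (lidemX θ s (dmul s A))
      = lidemX θ s (truncX s (addRow s i j α (addCol j i (-α) (dmul s A)))) := by
  rw [actionX_lidemX, dmul_coe, addCol_permMat_mul, addRow_permMat_mul, toMat_rootK_inv,
    rho_rootK_of_mem_setL hK hL, rootK_inv, cocycle_rootK_of_mem_setL hK hL,
    AddChar.map_zero_eq_one, one_smul]
  simp [Matrix.mul_assoc]

/-- No position `(i, b)` lies in `J`, so row `i` of `A` is zero. It stays zero under column
operations, since these multiply from the right. -/
theorem addRow_addCol_dmul_of_highest {s : Tableau lam} {i : Idx lam} (j : Idx lam)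
    (hi : ∀ l, row s i ≤ row s l) (α β : F) (A : suppSpace F (setJ s)) :
    addRow s i j α (addCol j i β (dmul s A)) = addCol j i β (dmul s A) := by
  have h0 : ∀ b, (A : Matrix (Idx lam) (Idx lam) F) i b = 0 := fun b =>
    A.2 i b fun h => (mem_setJ.1 h).2.not_ge (hi b)
  have h : Matrix.single j i α * (A : Matrix (Idx lam) (Idx lam) F) = 0 := by
    ext a b
    by_cases ha : a = j
    · subst ha
      simp [h0]
    · simp [ha]
  rw [dmul_coe, addCol_permMat_mul, addRow_permMat_mul, ← Matrix.mul_assoc (1 + _),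
    Matrix.add_mul 1, h, Matrix.one_mul, add_zero]

/-- No position `(a, j)` lies in `J`, so the column being added is zero. -/
theorem addCol_dmul_of_lowest {s : Tableau lam} {i j : Idx lam} (hj : ∀ l, row s l ≤ row s j)
    (β : F) (A : suppSpace F (setJ s)) :
    addCol j i β (dmul s A) = (dmul s A : Matrix (Idx lam) (Idx lam) F) := by
  have h0 : ∀ a, (A : Matrix (Idx lam) (Idx lam) F) a j = 0 := fun a =>
    A.2 a j fun h => (mem_setJ.1 h).2.not_ge (hj a)
  have h : (A : Matrix (Idx lam) (Idx lam) F) * Matrix.single j i β = 0 := by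
    ext a b
    by_cases hb : b = i
    · subst hb
      simp [h0]
    · simp [hb]
  rw [dmul_coe, addCol_permMat_mul, Matrix.mul_add, h, Matrix.mul_one, add_zero]

end Lidempotents

end SComp

namespace SComp

/-! ### Cosets of the parabolic subgroup and the elements absorbed by `P̄_λ d`. -/

section Component

variable {k : ℕ} {lam : Fin k → ℕ} {F : Type*} [Field F] [Finite F]

theorem parabolicSum_mul_single_of_mem {h : GL (Idx lam) F} (hh : h ∈ parabolic F lam)
    (g : GL (Idx lam) F) :
    parabolicSum F lam * MonoidAlgebra.single (h * g) 1
      = parabolicSum F lam * MonoidAlgebra.single g 1 := by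
  simp only [parabolicSum, Finset.sum_mul, MonoidAlgebra.single_mul_single, mul_one]
  refine Fintype.sum_equiv (Equiv.mulRight ⟨h, hh⟩) _ _ fun x => ?_
  simp [mul_assoc]

theorem coeff_parabolicSum_mul_single (g x : GL (Idx lam) F) [Decidable (x * g⁻¹ ∈ parabolic F lam)] :
    (parabolicSum F lam * MonoidAlgebra.single g (1 : ℂ)).coeff x
      = if x * g⁻¹ ∈ parabolic F lam then 1 else 0 := by
  classical
  simp only [parabolicSum, Finset.sum_mul, MonoidAlgebra.single_mul_single, mul_one,
    MonoidAlgebra.coeff_sum, Finsupp.finsetSum_apply, MonoidAlgebra.coeff_single,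
    Finsupp.single_apply]
  split_ifs with h
  · rw [Finset.sum_eq_single ⟨x * g⁻¹, h⟩]
    · simp
    · intro b _ hb
      rw [if_neg]
      rintro rfl
      exact hb (by simp)
    · simp
  · refine Finset.sum_eq_zero fun b _ => ?_
    rw [if_neg]
    rintro rfl
    exact h (by simp)

theorem coe_permGL (w : Equiv.Perm (Idx lam)) :
    ((permGL w : GL (Idx lam) F) : Matrix (Idx lam) (Idx lam) F) = permMat F w := rfl

theorem permGL_conj_apply (w : Equiv.Perm (Idx lam)) (g : GL (Idx lam) F) (a b : Idx lam) :
    ((permGL w * g * (permGL w)⁻¹ : GL (Idx lam) F) : Matrix (Idx lam) (Idx lam) F) a b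
      = (g : Matrix (Idx lam) (Idx lam) F) (w a) (w b) := by
  have h : ((permGL w : GL (Idx lam) F)⁻¹ : GL (Idx lam) F) = permGL w⁻¹ := by
    rw [inv_eq_iff_mul_eq_one]
    ext a b
    rw [Units.val_mul, coe_permGL, coe_permGL, permMat_mul_apply]
    simp [permMat, Equiv.Perm.permMatrix, PEquiv.toMatrix_apply, Matrix.one_apply]
  rw [h, Units.val_mul, Units.val_mul, coe_permGL, coe_permGL, Matrix.mul_assoc,
    permMat_mul_apply]
  simp only [permMat, Equiv.Perm.permMatrix, PEquiv.mul_toMatrix_toPEquiv]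
  rfl

/-- `P_lam ^ d` consists of the matrices with zero entries at all `(i, j)` with
`row i > row j`. -/
theorem permGL_conj_mem_parabolic {s : Tableau lam} {g : GL (Idx lam) F} :
    permGL (dperm s) * g * (permGL (dperm s))⁻¹ ∈ parabolic F lam ↔
      ∀ i j, row s j < row s i → (g : Matrix (Idx lam) (Idx lam) F) i j = 0 := by
  change (∀ a b, row (initial lam) b < row (initial lam) a →
    ((permGL (dperm s) * g * (permGL (dperm s))⁻¹ : GL (Idx lam) F) :
      Matrix (Idx lam) (Idx lam) F) a b = 0) ↔ _
  simp only [permGL_conj_apply, ← row_dperm s]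
  refine ⟨fun h i j hij => ?_, fun h a b => h _ _⟩
  simpa using h ((dperm s).symm i) ((dperm s).symm j) (by simpa using hij)

/-- Write `d w = (d w d⁻¹) d`; the first factor lies in `P_λ` and is absorbed by `P̄_λ`. Applied to
`w ∈ U_{J^c}` for the span and to `w = ρ(g⁻¹)` for equivariance. -/
theorem parabolicSum_mul_single_permGL_mul {s : Tableau lam} {w : GL (Idx lam) F}
    (hw : ∀ i j, row s j < row s i → (w : Matrix (Idx lam) (Idx lam) F) i j = 0)
    (g : GL (Idx lam) F) :
    parabolicSum F lam * MonoidAlgebra.single (permGL (dperm s) * (w * g)) 1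
      = parabolicSum F lam * MonoidAlgebra.single (permGL (dperm s) * g) 1 := by
  rw [← parabolicSum_mul_single_of_mem (permGL_conj_mem_parabolic.2 hw) (permGL (dperm s) * g)]
  congr 2
  group

theorem closed_setJ (s : Tableau lam) : ClosedRoots (setJ s) := by
  intro i j l h1 h2
  rw [mem_setJ] at *
  exact ⟨h2.1.trans h1.1, h2.2.trans h1.2⟩

/-- The complement of `J` in the set of negative roots. -/
def setJc (s : Tableau lam) : Finset (Idx lam × Idx lam) :=
  (negRoots lam).filter fun p => row s p.1 ≤ row s p.2

theorem mem_setJc {s : Tableau lam} {i j : Idx lam} :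
    (i, j) ∈ setJc s ↔ j < i ∧ row s i ≤ row s j := by simp [setJc, negRoots]

theorem closed_setJc (s : Tableau lam) : ClosedRoots (setJc s) := by
  intro i j l h1 h2
  rw [mem_setJc] at *
  exact ⟨h2.1.trans h1.1, h1.2.trans h2.2⟩

theorem det_one_add_of_mem {A : Matrix (Idx lam) (Idx lam) F}
    (hA : A ∈ suppSpace F (negRoots lam)) : (1 + A).det = 1 := by
  have hz : ∀ i j : Idx lam, i ≤ j → A i j = 0 := fun i j hij =>
    hA i j fun h => absurd (mem_negRoots.1 h) (not_lt.2 hij)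
  rw [Matrix.det_of_isLowerTriangular]
  · simp [hz]
  · intro i j hij
    have hij' : i < j := hij
    simp [hz i j hij'.le, hij'.ne]

/-- A matrix `1 + A` with `A` strictly lower triangular, as an element of `GL_n(q)`. -/
def oneAdd (A : suppSpace F (negRoots lam)) : GL (Idx lam) F :=
  Matrix.GeneralLinearGroup.mkOfDetNeZero (1 + (A : Matrix (Idx lam) (Idx lam) F))
    (by rw [det_one_add_of_mem A.2]; exact one_ne_zero)

theorem suppSpace_mono {m : ℕ} {S T : Finset (Fin m × Fin m)} (h : S ⊆ T) :
    suppSpace F S ≤ suppSpace F T := fun _ hA i j hij => hA i j fun h' => hij (h h')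

theorem coe_oneAdd (A : suppSpace F (negRoots lam)) :
    (oneAdd A : Matrix (Idx lam) (Idx lam) F) = 1 + (A : Matrix (Idx lam) (Idx lam) F) := rfl

theorem setJ_subset_negRoots (s : Tableau lam) : setJ s ⊆ negRoots lam := Finset.filter_subset _ _

theorem setJc_subset_negRoots (s : Tableau lam) : setJc s ⊆ negRoots lam :=
  Finset.filter_subset _ _

theorem addD_dmul (s : Tableau lam) (A : suppSpace F (setJ s)) :
    addD s (dmul s A) = permGL (dperm s) *
      oneAdd (Submodule.inclusion (suppSpace_mono (setJ_subset_negRoots s)) A) := by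
  apply Units.ext
  rw [Units.val_mul, coe_permGL, coe_oneAdd, Matrix.mul_add, Matrix.mul_one, add_comm]
  rfl

/-- `U_J` meets `P_lam ^ d` trivially. -/
theorem eq_one_of_mem_patternSubgroup_setJ {s : Tableau lam} {w : GL (Idx lam) F}
    (hw : w ∈ patternSubgroup F (setJ s) (closed_setJ s))
    (h0 : ∀ i j, row s j < row s i → (w : Matrix (Idx lam) (Idx lam) F) i j = 0) : w = 1 := by
  ext i j
  by_cases h : (i, j) ∈ setJ s
  · rw [h0 i j (mem_setJ.1 h).2]
    simp [(mem_setJ.1 h).1.ne']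
  · have := hw i j h
    rw [Matrix.sub_apply, sub_eq_zero] at this
    simpa using this

theorem oneAdd_injective : Function.Injective (oneAdd (F := F) (lam := lam)) := by
  intro A B h
  have := congrArg (fun g : GL (Idx lam) F => (g : Matrix (Idx lam) (Idx lam) F)) h
  simp only [coe_oneAdd, add_right_inj] at this
  exact Subtype.ext this

theorem oneAdd_inclusion_mem {S : Finset (Idx lam × Idx lam)} (hS : ClosedRoots S)
    (h : S ⊆ negRoots lam) (A : suppSpace F S) :
    oneAdd (Submodule.inclusion (suppSpace_mono h) A) ∈ patternSubgroup F S hS := by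
  rw [mem_patternSubgroup, coe_oneAdd, add_sub_cancel_left]
  exact A.2

theorem apply_eq_zero_of_mem_patternSubgroup_setJc {s : Tableau lam} {w : GL (Idx lam) F}
    (hw : w ∈ patternSubgroup F (setJc s) (closed_setJc s)) (i j : Idx lam)
    (h : row s j < row s i) : (w : Matrix (Idx lam) (Idx lam) F) i j = 0 := by
  have h1 := hw i j fun h' => (mem_setJc.1 h').2.not_gt h
  have hij : i ≠ j := by
    rintro rfl
    exact lt_irrefl _ h
  simpa [hij] using h1

/-! ### Factorization of the unitriangular group, by counting. -/

/-- `U = U_{J^c} U_J`, where `J^c` is the complement of `J` in the set of negative roots. -/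
theorem exists_mul_oneAdd_eq (s : Tableau lam)
    (u : patternSubgroup F (negRoots lam) (closed_negRoots lam)) :
    ∃ w ∈ patternSubgroup F (setJc s) (closed_setJc s), ∃ A : suppSpace F (setJ s),
      (u : GL (Idx lam) F)
        = w * oneAdd (Submodule.inclusion (suppSpace_mono (setJ_subset_negRoots s)) A) := by
  let ι := fun A : suppSpace F (setJ s) =>
    oneAdd (Submodule.inclusion (suppSpace_mono (setJ_subset_negRoots s)) A)
  let κ := fun A : suppSpace F (setJc s) =>
    oneAdd (Submodule.inclusion (suppSpace_mono (setJc_subset_negRoots s)) A)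
  have hι : ∀ A, ι A ∈ patternSubgroup F (setJ s) (closed_setJ s) :=
    oneAdd_inclusion_mem (closed_setJ s) (setJ_subset_negRoots s)
  have hκ : ∀ A, κ A ∈ patternSubgroup F (setJc s) (closed_setJc s) :=
    oneAdd_inclusion_mem (closed_setJc s) (setJc_subset_negRoots s)
  have hle : ∀ {S : Finset (Idx lam × Idx lam)} (hS : ClosedRoots S) (h : S ⊆ negRoots lam),
      patternSubgroup F S hS ≤ patternSubgroup F (negRoots lam) (closed_negRoots lam) :=
    fun _ h g hg => suppSpace_mono h hg
  let m : suppSpace F (setJc s) × suppSpace F (setJ s) →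
      patternSubgroup F (negRoots lam) (closed_negRoots lam) := fun p =>
    ⟨κ p.1 * ι p.2, mul_mem (hle _ (setJc_subset_negRoots s) (hκ _))
      (hle _ (setJ_subset_negRoots s) (hι _))⟩
  -- Two factorizations of one element give an element of `U_J` that is also in `U_{J^c}`. Its
  -- entries vanish on `J`, so it is trivial.
  have hm : Function.Injective m := by
    rintro ⟨B, A⟩ ⟨B', A'⟩ h
    have h1 : κ B * ι A = κ B' * ι A' := congrArg Subtype.val h
    have h2 : (κ B')⁻¹ * κ B = ι A' * (ι A)⁻¹ := by
      rw [inv_mul_eq_iff_eq_mul, ← mul_assoc, eq_mul_inv_iff_mul_eq, h1]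
    have h3 : ι A' * (ι A)⁻¹ = 1 := by
      refine eq_one_of_mem_patternSubgroup_setJ (mul_mem (hι _) (inv_mem (hι _))) ?_
      rw [← h2]
      exact apply_eq_zero_of_mem_patternSubgroup_setJc (mul_mem (inv_mem (hκ _)) (hκ _))
    have h4 : κ B' = κ B := by rwa [h3, inv_mul_eq_one] at h2
    have h5 : ι A' = ι A := mul_inv_eq_one.1 h3
    rw [Prod.mk.injEq]
    exact ⟨Submodule.inclusion_injective _ (oneAdd_injective h4.symm),
      Submodule.inclusion_injective _ (oneAdd_injective h5.symm)⟩
  -- Splitting the entries of `g - E` between `J^c` and `J` bounds `|U|` by the number of pairs. No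
  -- multiplicative property of `r` is needed.
  let r : patternSubgroup F (negRoots lam) (closed_negRoots lam) →
      suppSpace F (setJc s) × suppSpace F (setJ s) := fun g =>
    (⟨proj (setJc s) (g.1 - 1 : Matrix (Idx lam) (Idx lam) F), proj_mem _ _⟩,
      ⟨proj (setJ s) (g.1 - 1 : Matrix (Idx lam) (Idx lam) F), proj_mem _ _⟩)
  have hr : Function.Injective r := by
    intro g h e
    have e1 := congrArg (fun p => (p.1 : Matrix (Idx lam) (Idx lam) F)) e
    have e2 := congrArg (fun p => (p.2 : Matrix (Idx lam) (Idx lam) F)) e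
    ext i j
    rw [← sub_left_inj (a := (1 : Matrix (Idx lam) (Idx lam) F) i j), ← Matrix.sub_apply,
      ← Matrix.sub_apply]
    by_cases hN : (i, j) ∈ negRoots lam
    · rcases le_or_gt (row s i) (row s j) with hij | hij
      · have := congrFun (congrFun e1 i) j
        simpa [r, proj, mem_setJc.2 ⟨mem_negRoots.1 hN, hij⟩] using this
      · have := congrFun (congrFun e2 i) j
        simpa [r, proj, mem_setJ.2 ⟨mem_negRoots.1 hN, hij⟩] using this
    · rw [g.2 i j hN, h.2 i j hN]
  -- Injections in both directions between finite sets: the cardinalities agree, so the product map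
  -- `m` is also surjective.
  have hcard := (Nat.card_le_card_of_injective m hm).antisymm (Nat.card_le_card_of_injective r hr)
  obtain ⟨⟨B, A⟩, hu⟩ := ((Nat.bijective_iff_injective_and_card m).2 ⟨hm, hcard⟩).2 u
  exact ⟨κ B, hκ B, A, congrArg Subtype.val hu.symm⟩

/-! ### The isomorphism onto the `s`-component. -/

theorem toCompM_injective (s : Tableau lam) : Function.Injective (toCompM F s) := by
  classical
  -- The cosets `P_λ du`, `u ∈ U_J`, are pairwise distinct because `U_J` meets `d⁻¹ P_λ d`
  -- trivially. So the coefficient of the image at `du` recovers the coefficient at `du - d`.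
  have hiff : ∀ X Y : X0 F s, addD s X * (addD s Y)⁻¹ ∈ parabolic F lam ↔ X = Y := by
    intro X Y
    refine ⟨fun h => ?_, fun h => by simp [h]⟩
    obtain ⟨A, rfl⟩ := (dmul s).surjective X
    obtain ⟨B, rfl⟩ := (dmul s).surjective Y
    have hι := oneAdd_inclusion_mem (F := F) (closed_setJ s) (setJ_subset_negRoots s)
    rw [addD_dmul, addD_dmul, mul_inv_rev, ← mul_assoc, mul_assoc (permGL (dperm s)),
      permGL_conj_mem_parabolic] at h
    have h1 := eq_one_of_mem_patternSubgroup_setJ (mul_mem (hι A) (inv_mem (hι B))) h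
    rw [Submodule.inclusion_injective _ (oneAdd_injective (mul_inv_eq_one.1 h1))]
  have hcoeff : ∀ (x : AddMonoidAlgebra ℂ (X0 F s)) (X : X0 F s),
      (toCompM F s x).coeff (addD s X) = x.coeff X := by
    intro x X
    induction x using AddMonoidAlgebra.induction_linear with
    | zero => simp
    | add x y hx hy => simp [hx, hy]
    | single Y c =>
      have : (AddMonoidAlgebra.single Y c : AddMonoidAlgebra ℂ (X0 F s))
          = c • AddMonoidAlgebra.single Y 1 := by simp
      rw [this, map_smul, toCompM_single, MonoidAlgebra.coeff_smul, Finsupp.smul_apply,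
        coeff_parabolicSum_mul_single]
      simp [hiff, Finsupp.single_apply, eq_comm]
  intro x y h
  ext X
  rw [← hcoeff, h, hcoeff]

theorem range_toCompM (s : Tableau lam) : LinearMap.range (toCompM F s) = compM F s := by
  apply le_antisymm
  · rintro _ ⟨x, rfl⟩
    induction x using AddMonoidAlgebra.induction_linear with
    | zero => simp
    | add x y hx hy =>
      rw [map_add]
      exact add_mem hx hy
    | single X c =>
      have : (AddMonoidAlgebra.single X c : AddMonoidAlgebra ℂ (X0 F s))
          = c • AddMonoidAlgebra.single X 1 := by simp
      obtain ⟨A, rfl⟩ := (dmul s).surjective X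
      rw [this, map_smul, toCompM_single, addD_dmul]
      let u : patternSubgroup F (negRoots lam) (closed_negRoots lam) :=
        ⟨oneAdd (Submodule.inclusion (suppSpace_mono (setJ_subset_negRoots s)) A),
          suppSpace_mono (setJ_subset_negRoots s)
            (oneAdd_inclusion_mem (closed_setJ s) (setJ_subset_negRoots s) A)⟩
      exact Submodule.smul_mem _ _ (Submodule.subset_span ⟨u, rfl⟩)
  · refine Submodule.span_le.2 ?_
    rintro _ ⟨u, rfl⟩
    -- The factor `w ∈ U_{J^c}` is absorbed by `P̄_λ d`, so each generator already comes from `U_J`.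
    obtain ⟨w, hw, A, hu⟩ := exists_mul_oneAdd_eq s u
    refine ⟨AddMonoidAlgebra.single (dmul s A) 1, ?_⟩
    simp only
    rw [toCompM_single, addD_dmul, hu, parabolicSum_mul_single_permGL_mul
      (apply_eq_zero_of_mem_patternSubgroup_setJc hw)]

/-- The value `ρ(g)` as an element of `GL_n(q)`. -/
def rhoGL (s : Tableau lam) (g : groupK F s) : GL (Idx lam) F where
  val := rho s g
  inv := rho s g⁻¹
  val_inv := by rw [← rho_mul, mul_inv_cancel, rho_one]
  inv_val := by rw [← rho_mul, inv_mul_cancel, rho_one]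

theorem rho_apply_eq_zero (s : Tableau lam) (g : groupK F s) (i j : Idx lam)
    (h : row s j < row s i) : rho s g i j = 0 := by
  have hij : i ≠ j := by
    rintro rfl
    exact lt_irrefl _ h
  have hL : (i, j) ∉ setL s := fun hL => h.ne' (mem_setL.1 hL).2
  simp [rho, proj, hL, hij]

theorem toCompM_actionX (s : Tableau lam) (g : groupK F s) (x : AddMonoidAlgebra ℂ (X0 F s)) :
    toCompM F s (actionX s (MulOpposite.op g) x)
      = toCompM F s x * MonoidAlgebra.single (g : GL (Idx lam) F) 1 := by
  obtain ⟨y, rfl⟩ := (transport s).surjective x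
  rw [actionX_transport]
  induction y using AddMonoidAlgebra.induction_linear with
  | zero => simp
  | add x y hx hy => simp only [map_add, hx, hy, add_mul]
  | single A c =>
    have h1 : actionV s (MulOpposite.op g) (AddMonoidAlgebra.single A c)
        = c • AddMonoidAlgebra.single (affine s g A) 1 := by
      simp [actionV]
    have h2 : ∀ B : suppSpace F (setJ s), transport s (AddMonoidAlgebra.single B 1)
        = AddMonoidAlgebra.single (dmul s B) 1 := fun B => by simp [transport]
    have h3 : (AddMonoidAlgebra.single A c : AddMonoidAlgebra ℂ (suppSpace F (setJ s)))
        = c • AddMonoidAlgebra.single A 1 := by simp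
    -- The identity behind the cocycle: `E + (A ∘ g + f(g)) = ρ(g⁻¹)(E + A) g`. The left factor
    -- disappears after `P̄_λ d`, and right multiplication by `g` remains.
    have h4 : oneAdd (Submodule.inclusion (suppSpace_mono (setJ_subset_negRoots s)) (affine s g A))
        = rhoGL s g⁻¹ * (oneAdd (Submodule.inclusion (suppSpace_mono (setJ_subset_negRoots s)) A)
          * (g : GL (Idx lam) F)) := by
      apply Units.ext
      change (1 + (rho s g⁻¹ * (A : Matrix (Idx lam) (Idx lam) F) * toMat g
        + (rho s g⁻¹ * toMat g - 1)) : Matrix (Idx lam) (Idx lam) F)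
        = rho s g⁻¹ * ((1 + (A : Matrix (Idx lam) (Idx lam) F)) * toMat g)
      noncomm_ring
    rw [h1, h3]
    simp only [map_smul, h2, toCompM_single, addD_dmul, smul_mul_assoc, mul_assoc]
    rw [h4, parabolicSum_mul_single_permGL_mul (rho_apply_eq_zero s g⁻¹)]
    simp [MonoidAlgebra.single_mul_single, mul_assoc]

end Component

end SComp

theorem theorem4p9 {F : Type*} [Field F] [Finite F] (θ : AddChar F ℂ) (hθ : θ ≠ 1)
    {k : ℕ} (lam : Fin k → ℕ) (s : SComp.Tableau lam) (hs : SComp.IsRowStandard s) :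
    -- the `e_{dA}`, `A ∈ V_J`, form a basis of `ℂ(𝔛_s⁰, +)`
    (LinearIndependent ℂ
        (fun A : SComp.suppSpace F (SComp.setJ s) => SComp.lidemX θ s (SComp.dmul s A)) ∧
      Submodule.span ℂ (Set.range
        (fun A : SComp.suppSpace F (SComp.setJ s) => SComp.lidemX θ s (SComp.dmul s A))) = ⊤) ∧
    -- `du - d ↦ P̄_lam du` identifies `ℂ(𝔛_s⁰, +)` with `M_s` as right `U_K`-module
    (Function.Injective (SComp.toCompM F s) ∧
      LinearMap.range (SComp.toCompM F s) = SComp.compM F s ∧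
      ∀ (g : SComp.groupK F s) (x : AddMonoidAlgebra ℂ (SComp.X0 F s)),
        SComp.toCompM F s (SComp.actionX s (MulOpposite.op g) x)
          = SComp.toCompM F s x * MonoidAlgebra.single (g : GL (SComp.Idx lam) F) 1) ∧
    -- the action of the root elements `x_ij(α)`, `(i, j) ∈ K`
    ∀ (i j : SComp.Idx lam) (hK : (i, j) ∈ SComp.setK s) (α : F)
      (A : SComp.suppSpace F (SComp.setJ s)),
      ((i, j) ∈ SComp.setJ s →
        SComp.actionX s (MulOpposite.op (SComp.rootK hK α)) (SComp.lidemX θ s (SComp.dmul s A))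
          = θ ((A : Matrix (SComp.Idx lam) (SComp.Idx lam) F) i j * α) •
            SComp.lidemX θ s (SComp.truncX s (SComp.addCol j i (-α) (SComp.dmul s A)))) ∧
      ((i, j) ∈ SComp.setL s →
        SComp.actionX s (MulOpposite.op (SComp.rootK hK α)) (SComp.lidemX θ s (SComp.dmul s A))
          = SComp.lidemX θ s (SComp.truncX s
              (SComp.addRow s i j α (SComp.addCol j i (-α) (SComp.dmul s A))))) ∧
      -- highest compartment: column operation alone
      ((i, j) ∈ SComp.setL s → (∀ l, SComp.row s i ≤ SComp.row s l) →
        SComp.actionX s (MulOpposite.op (SComp.rootK hK α)) (SComp.lidemX θ s (SComp.dmul s A))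
          = SComp.lidemX θ s (SComp.truncX s (SComp.addCol j i (-α) (SComp.dmul s A)))) ∧
      -- lowest compartment: row operation alone
      ((i, j) ∈ SComp.setL s → (∀ l, SComp.row s l ≤ SComp.row s i) →
        SComp.actionX s (MulOpposite.op (SComp.rootK hK α)) (SComp.lidemX θ s (SComp.dmul s A))
          = SComp.lidemX θ s (SComp.truncX s (SComp.addRow s i j α (SComp.dmul s A)))) := by
  refine ⟨⟨SComp.linearIndependent_lidemX hθ s, SComp.span_lidemX_eq_top hθ s⟩,
    ⟨SComp.toCompM_injective s, SComp.range_toCompM s, SComp.toCompM_actionX s⟩,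
    fun i j hK α A => ⟨fun hJ => SComp.actionX_rootK_of_mem_setJ θ hK hJ α A,
      fun hL => SComp.actionX_rootK_of_mem_setL θ hK hL α A, fun hL hi => ?_, fun hL hi => ?_⟩⟩
  · rw [SComp.actionX_rootK_of_mem_setL θ hK hL, SComp.addRow_addCol_dmul_of_highest j hi]
  · rw [SComp.actionX_rootK_of_mem_setL θ hK hL,
      -- The vanishing column is column `j`, so the hypothesis on the row of `i` is carried over to
      -- `j`, which lies in the same row.
      SComp.addCol_dmul_of_lowest ((SComp.mem_setL.1 hL).2 ▸ hi)]
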